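/- Let $\mu\subseteq\lambda$ be partitions, where $\lambda$ has $b$ nonzero parts, and extend $\mu$ by zeros to $b$ parts. Let $a\ge 1$ and $\vec x=(x_1,\dots,x_a)$. Two finite matrices over a commutative ring $R$ (not necessarily square) are *stably equivalent* if they are related by a finite sequence of the operations $M\mapsto AM$ and $M\mapsto MA$ with $A$ invertible over $R$, and stabilization $M\mapsto\begin{pmatrix}1&0\\0&M\end{pmatrix}$ and its inverse (the order of rows and of columns is immaterial). Let $J=J(\lambda/\mu;\vec x)$ be the $b\times b$ matrix with entries $J_{i,j}=h_{\lambda_i-\mu_j-i+j}(\vec x)$ and $D=D(\lambda/\mu;\vec x)$ the $\lambda_1\times\lambda_1$ matrix with entries $D_{i,j}=e_{\lambda'_i-\mu'_j-i+j}(\vec x)$, where $h_n$ and $e_n$ are the complete and the elementary symmetric polynomials (zero for $n<0$) and $'$ denotes conjugation of partitions. Consider the left-leaning parallelogram of height $a$ and width $\lambda_1+b$ in the triangular lattice. Its rows of unit triangles are numbered $1,\dots,a$ from the bottom. In the bottom row remove the upward triangles whose bases are at the positions $\lambda_i+b+1-i$ from the left, and in the top row remove the downward triangles whose top sides are at the positions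 $\mu_i+b+1-i$ from the left ($1\le i\le b$). Let $Z(\lambda/\mu;\vec x)$ be the planar graph dual to the tiling of the resulting region by unit triangles, where the edges that point northeast from an upward triangle of row $i$ to the downward triangle on its right have weight $x_i$, and all other edges have weight $1$. Give each edge a sign such that every bounded face (all of them are hexagons) has an even number of minus signs, and let $M=M(\lambda/\mu;\vec x)$ be the resulting Kasteleyn–Percus matrix: its rows are indexed by the downward triangles, its columns by the upward triangles, and its entries are sign times weight for edges and $0$ for non-edges. (For the opposite naming of the two colors of the bipartite graph, the Kasteleyn–Percus matrix is $M^T$.) Then for every such choice of signs, over the ring $\mathbb Z[\vec x]$, $J$ is stably equivalent to $M$, and $D$ is stably equivalent to $M^T$. Also, $J$ is stably equivalent to $D^T$. -/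

import Mathlib

open scoped Matrix

/-- Stable equivalence of (not necessarily square) finite matrices over a commutative ring: the
equivalence relation generated by general row operations `M ↦ A * M` and general column operations
`M ↦ M * A` with `A` invertible, and stabilization `M ↦ diag(1, M)`.  The rows and columns may be
indexed by arbitrary finite types, and relabelling them is allowed. -/
inductive StablyEquiv {R : Type} [CommRing R] : {m n m' n' : Type} →
    Matrix m n R → Matrix m' n' R → Prop
  | row {m n : Type} [Fintype m] [DecidableEq m] [Fintype n] (A : Matrix m m R) (M : Matrix m n R)
      (hA : IsUnit A) : StablyEquiv M (A * M)
  | col {m n : Type} [Fintype m] [Fintype n] [DecidableEq n] (A : Matrix n n R) (M : Matrix m n R)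
      (hA : IsUnit A) : StablyEquiv M (M * A)
  | stab {m n : Type} [Fintype m] [Fintype n] (M : Matrix m n R) :
      StablyEquiv M (Matrix.fromBlocks (1 : Matrix Unit Unit R) 0 0 M)
  | relabel {m n m' n' : Type} [Fintype m] [Fintype n] (e : m ≃ m') (f : n ≃ n')
      (M : Matrix m n R) : StablyEquiv M (Matrix.reindex e f M)
  | symm {m n m' n' : Type} {M : Matrix m n R} {M' : Matrix m' n' R} :
      StablyEquiv M M' → StablyEquiv M' M
  | trans {m n m' n' m'' n'' : Type} {M : Matrix m n R} {M' : Matrix m' n' R}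
      {M'' : Matrix m'' n'' R} : StablyEquiv M M' → StablyEquiv M' M'' → StablyEquiv M M''

namespace JacobiTrudi

/-- The complete symmetric polynomial `h_n(x_1, …, x_a)`, zero for `n < 0`. -/
noncomputable def h (a : ℕ) (n : ℤ) : MvPolynomial (Fin a) ℤ :=
  if 0 ≤ n then MvPolynomial.hsymm (Fin a) ℤ n.toNat else 0

/-- The elementary symmetric polynomial `e_n(x_1, …, x_a)`, zero for `n < 0`. -/
noncomputable def e (a : ℕ) (n : ℤ) : MvPolynomial (Fin a) ℤ :=
  if 0 ≤ n then MvPolynomial.esymm (Fin a) ℤ n.toNat else 0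

/-- The number `b` of nonzero parts of a partition. -/
abbrev numParts (lam : YoungDiagram) : ℕ := lam.colLen 0

/-- The Jacobi-Trudi matrix, `(i, j) ↦ h_{λ_i - μ_j - i + j}`, where `1 ≤ i, j ≤ b`
(both indices are shifted by one here). -/
noncomputable def jacobiTrudi (lam mu : YoungDiagram) (a : ℕ) :
    Matrix (Fin (numParts lam)) (Fin (numParts lam)) (MvPolynomial (Fin a) ℤ) :=
  Matrix.of fun i j => h a ((lam.rowLen i : ℤ) - (mu.rowLen j : ℤ) - (i : ℤ) + (j : ℤ))

/-- The dual Jacobi-Trudi matrix, `(i, j) ↦ e_{λ'_i - μ'_j - i + j}`, where `1 ≤ i, j ≤ λ_1`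
(both indices are shifted by one here). -/
noncomputable def dualJacobiTrudi (lam mu : YoungDiagram) (a : ℕ) :
    Matrix (Fin (lam.rowLen 0)) (Fin (lam.rowLen 0)) (MvPolynomial (Fin a) ℤ) :=
  Matrix.of fun i j => e a ((lam.colLen i : ℤ) - (mu.colLen j : ℤ) - (i : ℤ) + (j : ℤ))

/-! ### The notched parallelogram

The parallelogram has height `a`, horizontal side `W = λ_1 + b`, and leans to the left: the lattice
point with coordinates `(k, r)`, `0 ≤ k ≤ W`, `0 ≤ r ≤ a`, is the point `k + r * exp (2πi/3)` of
the plane.  Rows (from the bottom) and columns (from the left) of triangles are counted from 0.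
* The up triangle `(r, k)` has corners `(k, r)`, `(k + 1, r)`, `(k + 1, r + 1)`.
* The down triangle `(r, k)` has corners `(k, r + 1)`, `(k + 1, r + 1)`, `(k, r)`. -/

/-- The horizontal side length `λ_1 + b` of the parallelogram. -/
abbrev width (lam : YoungDiagram) : ℕ := lam.rowLen 0 + numParts lam

/-- There is a notch at the position of index `k` (counted from 0), i.e. `k + 1 = ν_i + b + 1 - i`
for some `1 ≤ i ≤ b`. -/
def Notch (b : ℕ) (nu : YoungDiagram) (k : ℕ) : Prop :=
  ∃ i < b, k + 1 + i = nu.rowLen i + b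

instance (b : ℕ) (nu : YoungDiagram) : DecidablePred (Notch b nu) := fun k =>
  inferInstanceAs (Decidable (∃ i < b, k + 1 + i = nu.rowLen i + b))

/-- Up triangles `(row, column)` of the region: in the bottom row those at the notches given by
`λ` are removed. -/
def UpTriangle (lam : YoungDiagram) (a : ℕ) : Type :=
  {t : Fin a × Fin (width lam) // ¬ ((t.1 : ℕ) = 0 ∧ Notch (numParts lam) lam t.2)}

/-- Down triangles `(row, column)` of the region: in the top row those at the notches given by
`μ` (extended by zeros to `b` parts) are removed. -/
def DownTriangle (lam mu : YoungDiagram) (a : ℕ) : Type :=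
  {t : Fin a × Fin (width lam) // ¬ ((t.1 : ℕ) + 1 = a ∧ Notch (numParts lam) mu t.2)}

variable {lam mu : YoungDiagram} {a : ℕ}

instance : Fintype (UpTriangle lam a) :=
  inferInstanceAs (Fintype {_t : Fin a × Fin (width lam) // _})

instance : DecidableEq (UpTriangle lam a) :=
  inferInstanceAs (DecidableEq {_t : Fin a × Fin (width lam) // _})

instance : Fintype (DownTriangle lam mu a) :=
  inferInstanceAs (Fintype {_t : Fin a × Fin (width lam) // _})

instance : DecidableEq (DownTriangle lam mu a) :=
  inferInstanceAs (DecidableEq {_t : Fin a × Fin (width lam) // _})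

def UpTriangle.row (u : UpTriangle lam a) : Fin a := u.1.1

def UpTriangle.col (u : UpTriangle lam a) : ℕ := u.1.2

def DownTriangle.row (d : DownTriangle lam mu a) : Fin a := d.1.1

def DownTriangle.col (d : DownTriangle lam mu a) : ℕ := d.1.2

/-- `d` and `u` share the left side of `u`. -/
def LeftAdj (d : DownTriangle lam mu a) (u : UpTriangle lam a) : Prop :=
  d.row = u.row ∧ d.col = u.col

/-- `d` and `u` share the right side of `u`: the dual edge points northeast from `u` to `d`. -/
def RightAdj (d : DownTriangle lam mu a) (u : UpTriangle lam a) : Prop :=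
  d.row = u.row ∧ d.col = u.col + 1

/-- `d` and `u` share the horizontal side of `u`: the dual edge is vertical. -/
def BaseAdj (d : DownTriangle lam mu a) (u : UpTriangle lam a) : Prop :=
  (d.row : ℕ) + 1 = u.row ∧ d.col = u.col

open Classical in
/-- The weighted graph dual to the tiling of the region by triangles, as a bipartite weight
function: northeast-pointing edges in the `r`-th row have weight `x_r`, all other edges have
weight `1`, and non-edges have weight `0`. -/
noncomputable def weight (d : DownTriangle lam mu a) (u : UpTriangle lam a) :
    MvPolynomial (Fin a) ℤ :=
  if LeftAdj d u then 1
  else if BaseAdj d u then 1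
  else if RightAdj d u then MvPolynomial.X u.row
  else 0

/-- Kasteleyn flatness of a sign decoration of the edges.  A notch is open to the outside, so
the bounded faces of the dual graph are the hexagons around the lattice points all of whose six
surrounding triangles belong to the region.  A face with six sides must have an even number of
minus signs.  The triangles are listed in cyclic order around the lattice point
`(u₁.col + 1, u₁.row + 1)`.  The values of `s` at pairs that are not edges play no role. -/
def KasteleynFlat (s : DownTriangle lam mu a → UpTriangle lam a → ℤˣ) : Prop :=
  ∀ (u₁ u₂ u₃ : UpTriangle lam a) (d₁ d₂ d₃ : DownTriangle lam mu a),
    LeftAdj d₁ u₁ → BaseAdj d₁ u₂ → RightAdj d₂ u₂ → LeftAdj d₂ u₃ → BaseAdj d₃ u₃ →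
    RightAdj d₃ u₁ →
    s d₁ u₁ * s d₁ u₂ * s d₂ u₂ * s d₂ u₃ * s d₃ u₃ * s d₃ u₁ = 1

/-- The Kasteleyn-Percus matrix of the weighted dual graph for the sign decoration `s`, with the
down triangles as black vertices (rows) and the up triangles as white vertices (columns).  For the
opposite naming of the two colors one gets the transpose. -/
noncomputable def kasteleynPercus (s : DownTriangle lam mu a → UpTriangle lam a → ℤˣ) :
    Matrix (DownTriangle lam mu a) (UpTriangle lam a) (MvPolynomial (Fin a) ℤ) :=
  Matrix.of fun d u => ((s d u : ℤ) : MvPolynomial (Fin a) ℤ) * weight d u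

/-- The decoration of all edges by `+` is Kasteleyn flat. -/
theorem kasteleynFlat_one :
    KasteleynFlat (fun (_ : DownTriangle lam mu a) (_ : UpTriangle lam a) => 1) := by
  intro _ _ _ _ _ _ _ _ _ _ _ _
  simp

end JacobiTrudi

/-! Both J ~ Dᵀ and J ~ M (for all signs +) are instances of one fact, `StablyEquiv.complementary`.
If `P * Q = 1`, the submatrix of `Q` with rows q and columns p is stably equivalent to what remains
of `P` after deleting rows p and columns q. This lifts Jacobi's complementary minor identity from
determinants to matrices.

Let E(t) = ∏ (1 + x_i t), whose inverse is H(-t), and turn power series into lower triangular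
Toeplitz matrices of size λ_1 + b. The notches of λ (rows) and of μ (columns) cut J out of the
matrix of H(-t), up to row and column signs; the complementary submatrix of the matrix of E(t) is
Dᵀ.

For M, the matrix of the full parallelogram is block bidiagonal: Toeplitz blocks of 1 + x_r t on the
diagonal, identity blocks above it. The corner block of its inverse comes from ±H(-t)
(`exists_inverse_bidiagonal`), so deleting the notched triangles leaves the complement of J again.

Any flat signs differ from + by signs attached to the triangles (`KasteleynFlat.exists_gauge`), that
is, by invertible diagonal matrices. Transposing Dᵀ ~ M gives D ~ Mᵀ. -/

namespace StablyEquiv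

/-! ### Calculus of stable equivalence -/

variable {R : Type} [CommRing R]

theorem refl {m n : Type} [Fintype m] [Fintype n] (M : Matrix m n R) : StablyEquiv M M := by
  classical
  simpa using StablyEquiv.row (1 : Matrix m m R) M isUnit_one

theorem transpose {m n m' n' : Type} {M : Matrix m n R} {M' : Matrix m' n' R}
    (hM : StablyEquiv M M') : StablyEquiv Mᵀ M'ᵀ := by
  induction hM with
  | row A M hA =>
    rw [Matrix.transpose_mul]
    exact .col _ _ ((Matrix.isUnit_transpose A).2 hA)
  | col A M hA =>
    rw [Matrix.transpose_mul]
    exact .row _ _ ((Matrix.isUnit_transpose A).2 hA)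
  | stab M =>
    rw [Matrix.fromBlocks_transpose, Matrix.transpose_one, Matrix.transpose_zero,
      Matrix.transpose_zero]
    exact .stab _
  | relabel e f M => exact .relabel f e _
  | symm _ ih => exact ih.symm
  | trans _ _ ih₁ ih₂ => exact ih₁.trans ih₂

theorem submatrix {m n m' n' : Type} [Fintype m] [Fintype n] (M : Matrix m n R) (e : m' ≃ m)
    (f : n' ≃ n) : StablyEquiv M (M.submatrix e f) :=
  .relabel e.symm f.symm M

theorem fin_stab {m n : Type} [Fintype m] [Fintype n] (M : Matrix m n R) (k : ℕ) :
    StablyEquiv M (Matrix.fromBlocks (1 : Matrix (Fin k) (Fin k) R) 0 0 M) := by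
  induction k with
  | zero =>
    convert StablyEquiv.submatrix M (Equiv.emptySum (Fin 0) m) (Equiv.emptySum (Fin 0) n)
    ext (i | i) (j | j)
    · exact i.elim0
    · exact i.elim0
    · exact j.elim0
    · rfl
  | succ k ih =>
    refine ih.trans ((StablyEquiv.stab _).trans ?_)
    let e : Fin (k + 1) ≃ Unit ⊕ Fin k :=
      finSumFinEquiv.symm.trans ((Equiv.sumComm _ _).trans
        (Equiv.sumCongr (Equiv.ofUnique (Fin 1) Unit) (Equiv.refl _)))
    let E (l : Type) : Fin (k + 1) ⊕ l ≃ Unit ⊕ (Fin k ⊕ l) :=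
      (Equiv.sumCongr e (Equiv.refl l)).trans (Equiv.sumAssoc _ _ _)
    convert StablyEquiv.submatrix _ (E m) (E n) using 1
    ext (i | i) (j | j)
    · have h : (1 : Matrix (Fin (k + 1)) (Fin (k + 1)) R) i j =
          (1 : Matrix (Unit ⊕ Fin k) (Unit ⊕ Fin k) R) (e i) (e j) := by
        simp [Matrix.one_apply]
      rw [Matrix.fromBlocks_apply₁₁, h, ← Matrix.fromBlocks_one]
      rcases hi : e i with x | x <;> rcases hj : e j with y | y <;> simp [E, hi, hj]
    · rcases hi : e i with x | x <;> simp [E, hi]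
    · rcases hj : e j with y | y <;> simp [E, hj]
    · simp [E]

theorem stab_left {m n k : Type} [Fintype m] [Fintype n] [Fintype k] [DecidableEq k]
    (M : Matrix m n R) : StablyEquiv M (Matrix.fromBlocks (1 : Matrix k k R) 0 0 M) := by
  refine (fin_stab M (Fintype.card k)).trans ?_
  convert StablyEquiv.submatrix _
    (Equiv.sumCongr (Fintype.equivFin k) (Equiv.refl m))
    (Equiv.sumCongr (Fintype.equivFin k) (Equiv.refl n)) using 1
  ext (i | i) (j | j) <;> simp [Matrix.one_apply]

theorem stab_right {m n k : Type} [Fintype m] [Fintype n] [Fintype k] [DecidableEq k]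
    (M : Matrix m n R) : StablyEquiv M (Matrix.fromBlocks M 0 0 (1 : Matrix k k R)) := by
  refine (stab_left (k := k) M).trans ?_
  convert StablyEquiv.submatrix _ (Equiv.sumComm m k) (Equiv.sumComm n k) using 1
  ext (i | i) (j | j) <;> simp

theorem fromBlocks_zero_one {m n k : Type} [Fintype m] [Fintype n] [Fintype k] [DecidableEq k]
    (A : Matrix m n R) (C : Matrix k n R) :
    StablyEquiv A (Matrix.fromBlocks A 0 C (1 : Matrix k k R)) := by
  classical
  refine (stab_right (k := k) A).trans ?_
  have hU : IsUnit (Matrix.fromBlocks (1 : Matrix n n R) 0 C (1 : Matrix k k R)) := by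
    simp [Matrix.isUnit_iff_isUnit_det]
  have := StablyEquiv.col _ (Matrix.fromBlocks A 0 0 (1 : Matrix k k R)) hU
  simpa [Matrix.fromBlocks_multiply] using this

theorem fromBlocks_one_zero {m n k : Type} [Fintype m] [Fintype n] [Fintype k] [DecidableEq k]
    (B : Matrix k n R) (D : Matrix m n R) :
    StablyEquiv D (Matrix.fromBlocks (1 : Matrix k k R) B 0 D) := by
  classical
  refine (stab_left (k := k) D).trans ?_
  have hU : IsUnit (Matrix.fromBlocks (1 : Matrix k k R) B 0 (1 : Matrix n n R)) := by
    simp [Matrix.isUnit_iff_isUnit_det]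
  have := StablyEquiv.col _ (Matrix.fromBlocks (1 : Matrix k k R) 0 0 D) hU
  simpa [Matrix.fromBlocks_multiply] using this

/-- Complementary submatrices of two mutually inverse matrices are stably equivalent. -/
theorem complementary {n : Type} [Fintype n] [DecidableEq n] {P Q : Matrix n n R}
    (hPQ : P * Q = 1) (p q : n → Prop) [DecidablePred p] [DecidablePred q] :
    StablyEquiv (Q.submatrix (fun i : {i // q i} => (i : n)) (fun j : {j // p j} => (j : n)))
      (P.submatrix (fun i : {i // ¬ p i} => (i : n)) (fun j : {j // ¬ q j} => (j : n))) := by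
  have hP : IsUnit P := .of_mul_eq_one _ hPQ
  -- The columns of `X` are the columns of `Q` in `p`, followed by the unit vectors outside `q`. The
  -- identity block makes `X` stably equivalent to the chosen submatrix of `Q`.
  let X : Matrix ({i // q i} ⊕ {i // ¬ q i}) ({j // p j} ⊕ {j // ¬ q j}) R :=
    Matrix.fromBlocks (Q.submatrix Subtype.val Subtype.val) 0
      (Q.submatrix Subtype.val Subtype.val) 1
  have hX₁ (l : n) (j : {j // p j}) : X ((Equiv.sumCompl q).symm l) (Sum.inl j) = Q l j := by
    by_cases hl : q l
    · rw [Equiv.sumCompl_symm_apply_of_pos hl]; rfl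
    · rw [Equiv.sumCompl_symm_apply_of_neg hl]; rfl
  have hX₂ (l : n) (j : {j // ¬ q j}) :
      X ((Equiv.sumCompl q).symm l) (Sum.inr j) = (1 : Matrix n n R) l j := by
    by_cases hl : q l
    · rw [Equiv.sumCompl_symm_apply_of_pos hl, Matrix.one_apply_ne (by rintro rfl; exact j.2 hl)]; rfl
    · rw [Equiv.sumCompl_symm_apply_of_neg hl]
      simp [X, Matrix.one_apply, Subtype.ext_iff]
  -- Multiplying by `P` exchanges the roles: columns of `Q` become unit vectors, and unit vectors
  -- become columns of `P`.
  have hY : (P * X.submatrix (Equiv.sumCompl q).symm (Equiv.refl _)).submatrix (Equiv.sumCompl p)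
      (Equiv.refl _) = Matrix.fromBlocks 1 (P.submatrix Subtype.val Subtype.val) 0
        (P.submatrix Subtype.val Subtype.val) := by
    have h₁ (i : n) (j : {j // p j}) :
        (P * X.submatrix (Equiv.sumCompl q).symm (Equiv.refl _)) i (Sum.inl j) =
          (1 : Matrix n n R) i j := by
      simp [← hPQ, Matrix.mul_apply, hX₁]
    have h₂ (i : n) (j : {j // ¬ q j}) :
        (P * X.submatrix (Equiv.sumCompl q).symm (Equiv.refl _)) i (Sum.inr j) = P i j := by
      simp [Matrix.mul_apply, hX₂, Matrix.one_apply]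
    ext (i | i) (j | j)
    · simpa [Matrix.one_apply, Subtype.ext_iff] using h₁ i j
    · simpa using h₂ i j
    · refine (h₁ i j).trans (Matrix.one_apply_ne fun h => i.2 (h ▸ j.2))
    · simpa using h₂ i j
  refine (fromBlocks_zero_one _ _).trans ((submatrix X (Equiv.sumCompl q).symm
    (Equiv.refl _)).trans ((StablyEquiv.row P _ hP).trans ((submatrix _ (Equiv.sumCompl p)
    (Equiv.refl _)).trans ?_)))
  rw [hY]
  exact (fromBlocks_one_zero _ _).symm

/-- Multiplying the entries of a matrix by units that depend on the row, and by units that depend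
on the column, does not change the stable equivalence class. -/
theorem of_units {m n : Type} [Fintype m] [Fintype n] {M N : Matrix m n R} (f : m → ℤˣ)
    (g : n → ℤˣ) (h : ∀ i j, N i j = ((f i : ℤ) : R) * ((g j : ℤ) : R) * M i j) :
    StablyEquiv M N := by
  classical
  have hu (k : Type) [Fintype k] [DecidableEq k] (f : k → ℤˣ) :
      IsUnit (Matrix.diagonal fun i => ((f i : ℤ) : R)) := by
    rw [Matrix.isUnit_iff_isUnit_det, Matrix.det_diagonal]
    exact IsUnit.prod_univ_iff.2 fun i => (f i).isUnit.map (Int.castRingHom R)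
  convert (StablyEquiv.row _ M (hu m f)).trans (.col _ _ (hu n g)) using 1
  ext i j
  rw [h, Matrix.mul_diagonal, Matrix.diagonal_mul]
  ring

end StablyEquiv

/-! ### Toeplitz matrices of power series -/

namespace PowerSeries

variable {R : Type} [CommRing R]

/-- The lower triangular Toeplitz matrix of the coefficients of a power series. -/
noncomputable def toeplitz (W : ℕ) : PowerSeries R →+* Matrix (Fin W) (Fin W) R where
  toFun f := Matrix.of fun i j => if j ≤ i then coeff (i - j : ℕ) f else 0
  map_zero' := by ext i j; simp
  map_one' := by
    ext i j
    simp only [Matrix.of_apply, coeff_one, Matrix.one_apply, Fin.ext_iff, Fin.le_def]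
    split_ifs <;> first | rfl | omega
  map_add' f g := by
    ext i j
    simp only [Matrix.of_apply, map_add, Matrix.add_apply]
    split_ifs <;> simp
  map_mul' f g := by
    ext i j
    simp only [Matrix.of_apply, Matrix.mul_apply, ite_mul, mul_ite, zero_mul, mul_zero]
    split_ifs with h
    · rw [coeff_mul]
      symm
      simp only [← Finset.sum_filter, ← ite_and]
      -- Only `k` with `j ≤ k ≤ i` contribute, so truncation to size `W` loses no term of the
      -- convolution.
      refine Finset.sum_bij (fun k _ => ((i : ℕ) - k, (k : ℕ) - j)) ?_ ?_ ?_ ?_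
      · intro k hk
        simp only [Finset.mem_filter, Finset.mem_univ, true_and, Finset.HasAntidiagonal.mem_antidiagonal,
          Fin.le_def] at hk h ⊢
        omega
      · intro k hk l hl
        simp only [Finset.mem_filter, Finset.mem_univ, true_and, Prod.mk.injEq,
          Fin.le_def, Fin.ext_iff] at hk hl ⊢
        omega
      · rintro ⟨s, t⟩ hst
        simp only [Finset.HasAntidiagonal.mem_antidiagonal, Fin.le_def] at hst h
        refine ⟨⟨j + t, by omega⟩, ?_, ?_⟩
        · simp only [Finset.mem_filter, Finset.mem_univ, true_and, Fin.le_def]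
          omega
        · simp only [Prod.mk.injEq]
          omega
      · intros; rfl
    · refine (Finset.sum_eq_zero fun k _ => ?_).symm
      split_ifs <;> first | rfl | omega

theorem toeplitz_apply (W : ℕ) (f : PowerSeries R) (i j : Fin W) :
    toeplitz W f i j = if j ≤ i then coeff (i - j : ℕ) f else 0 := rfl

theorem toeplitz_one_add_C_mul_X (W : ℕ) (x : R) (i j : Fin W) :
    toeplitz W (1 + C x * X) i j = if i = j then 1 else if (i : ℕ) = j + 1 then x else 0 := by
  rw [toeplitz_apply]
  by_cases h : j ≤ i
  · obtain ⟨n, hn⟩ := Nat.exists_eq_add_of_le (show (j : ℕ) ≤ i from h)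
    simp only [if_pos h, Fin.ext_iff, hn, Nat.add_sub_cancel_left]
    rcases n with _ | _ | n <;> simp [coeff_one]
  · have : ¬ (j : ℕ) ≤ i := h
    rw [if_neg h, if_neg (by rw [Fin.ext_iff]; omega), if_neg (by omega)]

theorem one_sub_mul_mk_pow (x : R) :
    (1 - C x * X) * (mk fun k => x ^ k) = 1 := by
  ext n
  cases n with
  | zero => simp [sub_mul, mul_assoc]
  | succ n => simp [sub_mul, mul_assoc, coeff_succ_X_mul, pow_succ', coeff_one]

end PowerSeries

/-! ### Generating functions of elementary and complete symmetric polynomials -/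

namespace MvPolynomial

variable (σ R : Type) [Fintype σ] [CommRing R]

theorem coeff_prod_one_add (n : ℕ) :
    PowerSeries.coeff n (∏ i : σ, (1 + PowerSeries.C (X i : MvPolynomial σ R) * PowerSeries.X)) = esymm σ R n := by
  rw [Finset.prod_one_add, map_sum, esymm, Finset.powersetCard_eq_filter, Finset.sum_filter]
  refine Finset.sum_congr rfl fun t _ => ?_
  rw [Finset.prod_mul_distrib, Finset.prod_const, ← map_prod, PowerSeries.coeff_C_mul_X_pow]
  simp only [eq_comm]

variable [DecidableEq σ]

theorem coeff_prod_mk_pow (n : ℕ) :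
    PowerSeries.coeff n (∏ i : σ, (PowerSeries.mk fun k => (X i : MvPolynomial σ R) ^ k)) = hsymm σ R n := by
  rw [PowerSeries.coeff_prod, hsymm]
  simp only [PowerSeries.coeff_mk]
  symm
  -- Multisets of size `n` correspond to exponent vectors of total degree `n`.
  refine Finset.sum_bij (fun s _ => Multiset.toFinsupp (s : Multiset σ)) ?_ ?_ ?_ ?_
  · intro s _
    rw [Finset.mem_finsuppAntidiag]
    refine ⟨?_, Finset.subset_univ _⟩
    exact (Multiset.sum_count_eq_card (fun i _ => Finset.mem_univ i)).trans s.2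
  · intro s _ t _ hst
    exact Subtype.ext (Multiset.toFinsupp.injective hst)
  · intro l hl
    rw [Finset.mem_finsuppAntidiag] at hl
    refine ⟨⟨Finsupp.toMultiset l, ?_⟩, Finset.mem_univ _, Finsupp.toMultiset_toFinsupp l⟩
    rw [Finsupp.card_toMultiset, Finsupp.sum_fintype _ _ (by simp)]
    exact hl.1
  · intro s _
    rw [Finset.prod_multiset_map_count]
    simp only [Multiset.toFinsupp_apply]
    refine Finset.prod_subset (Finset.subset_univ _) fun i _ hi => ?_
    rw [Multiset.count_eq_zero_of_notMem (by simpa using hi), pow_zero]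

/-- The generating functions of the elementary and of the complete symmetric polynomials. -/
theorem prod_one_add_mul_hsymm :
    (∏ i : σ, (1 + PowerSeries.C (X i : MvPolynomial σ R) * PowerSeries.X)) *
      (PowerSeries.mk fun n => (-1) ^ n * hsymm σ R n) = 1 := by
  -- Both factors are written as images under t ↦ -t, which reduces the claim to a product of
  -- geometric series.
  have h : (PowerSeries.mk fun n => (-1) ^ n * hsymm σ R n) =
      PowerSeries.rescale (-1 : MvPolynomial σ R)
        (∏ i : σ, (PowerSeries.mk fun k => (X i : MvPolynomial σ R) ^ k)) := by
    ext1 n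
    rw [PowerSeries.coeff_rescale, coeff_prod_mk_pow, PowerSeries.coeff_mk]
  have h' : (∏ i : σ, (1 + PowerSeries.C (X i : MvPolynomial σ R) * PowerSeries.X)) =
      PowerSeries.rescale (-1 : MvPolynomial σ R)
        (∏ i : σ, (1 - PowerSeries.C (X i : MvPolynomial σ R) * PowerSeries.X)) := by
    rw [map_prod]
    refine Finset.prod_congr rfl fun i _ => ?_
    ext1 n
    rcases n with _ | _ | n <;> simp [PowerSeries.coeff_one]
  rw [h, h', ← map_mul, ← Finset.prod_mul_distrib]
  simp [PowerSeries.one_sub_mul_mk_pow]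

end MvPolynomial

/-! ### Notches and their complement -/

theorem YoungDiagram.rowLen_le_of_le {mu lam : YoungDiagram} (hmu : mu ≤ lam) (i : ℕ) :
    mu.rowLen i ≤ lam.rowLen i := by
  by_contra! h
  exact lt_irrefl _ (mem_iff_lt_rowLen.1 (hmu (mem_iff_lt_rowLen.2 h)))

theorem YoungDiagram.colLen_le_of_le {mu lam : YoungDiagram} (hmu : mu ≤ lam) (j : ℕ) :
    mu.colLen j ≤ lam.colLen j := by
  by_contra! h
  exact lt_irrefl _ (mem_iff_lt_colLen.1 (hmu (mem_iff_lt_colLen.2 h)))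

namespace JacobiTrudi

variable {lam nu : YoungDiagram}

/-- A coincidence would force ν_i + ν'_j = i + j + 1 (indices from 0). But the cell (i, j) either
lies in ν, making the sum at least i + j + 2, or does not, making it at most i + j. -/
theorem not_notch (hnu : nu ≤ lam) (j : ℕ) :
    ¬ Notch (numParts lam) nu (numParts lam - nu.colLen j + j) := by
  rintro ⟨i, -, h⟩
  have h₁ := (nu.colLen_anti 0 j j.zero_le).trans (YoungDiagram.colLen_le_of_le hnu 0)
  have h₂ : j < nu.rowLen i ↔ i < nu.colLen j := by
    rw [← YoungDiagram.mem_iff_lt_rowLen, YoungDiagram.mem_iff_lt_colLen]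
  simp only [numParts] at h
  omega

theorem exists_equiv_notch (hnu : nu ≤ lam) :
    ∃ ε : Fin (numParts lam) ≃ {k : Fin (width lam) // Notch (numParts lam) nu k},
      ∀ i, ((ε i : Fin (width lam)) : ℕ) + 1 + i = nu.rowLen i + numParts lam := by
  have h₁ (i : Fin (numParts lam)) : nu.rowLen i + numParts lam - 1 - i < width lam := by
    have := (nu.rowLen_anti 0 i i.1.zero_le).trans (YoungDiagram.rowLen_le_of_le hnu 0)
    simp only [width]
    omega
  have h₂ (i : Fin (numParts lam)) :
      nu.rowLen i + numParts lam - 1 - i + 1 + i = nu.rowLen i + numParts lam := by omega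
  refine ⟨Equiv.ofBijective (fun i => ⟨⟨_, h₁ i⟩, i, i.2, h₂ i⟩) ⟨fun i j hij => ?_, ?_⟩, h₂⟩
  · have hij := congrArg (fun x => (x.1 : ℕ)) hij
    dsimp only at hij
    have hi := nu.rowLen_anti i j
    have hj := nu.rowLen_anti j i
    have := i.2
    have := j.2
    ext
    omega
  · rintro ⟨k, i, hi, h⟩
    refine ⟨⟨i, hi⟩, ?_⟩
    ext
    simp only
    omega

theorem exists_equiv_not_notch (hnu : nu ≤ lam) :
    ∃ ε : Fin (lam.rowLen 0) ≃ {k : Fin (width lam) // ¬ Notch (numParts lam) nu k},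
      ∀ j, ((ε j : Fin (width lam)) : ℕ) + nu.colLen j = numParts lam + j := by
  have h₁ (j : Fin (lam.rowLen 0)) : numParts lam - nu.colLen j + j < width lam := by
    simp only [width]
    omega
  have h₂ (j : ℕ) : nu.colLen j ≤ numParts lam :=
    (nu.colLen_anti 0 j j.zero_le).trans (YoungDiagram.colLen_le_of_le hnu 0)
  obtain ⟨δ, -⟩ := exists_equiv_notch hnu
  -- Surjectivity is a count: `width lam` positions minus b notches leaves λ_1.
  refine ⟨Equiv.ofBijective (fun j => ⟨⟨_, h₁ j⟩, not_notch hnu j⟩)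
    ((Fintype.bijective_iff_injective_and_card _).2 ⟨fun i j hij => ?_, ?_⟩), fun j => ?_⟩
  · have hij := congrArg (fun x => (x.1 : ℕ)) hij
    dsimp only at hij
    have hi := nu.colLen_anti i j
    have hj := nu.colLen_anti j i
    have := h₂ i
    have := h₂ j
    ext
    omega
  · rw [Fintype.card_subtype_compl, ← Fintype.card_congr δ]
    simp
  · have := h₂ j
    simp only [Equiv.ofBijective_apply]
    omega

end JacobiTrudi

/-! ### Gauge fixing for flat signs -/

namespace JacobiTrudi

/-- Gauge fixing for the signs `L`, `R` and `V` of the edges of the full parallelogram: if the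
signs are flat at all inner lattice points, they come from signs `f` of the down triangles and `g`
of the up triangles. -/
theorem exists_gauge_of_full (a W : ℕ) (L R V : ℕ → ℕ → ℤˣ)
    (hflat : ∀ r k, r + 1 < a → k + 1 < W →
      L r k * V r k * R (r + 1) k * L (r + 1) (k + 1) * V r (k + 1) * R r k = 1) :
    ∃ f g : ℕ → ℕ → ℤˣ, (∀ r k, L r k = f r k * g r k) ∧ (∀ r k, V r k = f r k * g (r + 1) k) ∧
      ∀ r k, r < a → k + 1 < W → R r k = f r (k + 1) * g r k := by
  -- `g` is propagated along the bottom row through `L` and `R`, then upwards through `L` and `V`.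
  -- Only the `R` edges above the bottom row remain, and flatness gives them row by row.
  let g₀ : ℕ → ℤˣ := fun k => Nat.rec 1 (fun k x => R 0 k * L 0 (k + 1) * x) k
  let g : ℕ → ℕ → ℤˣ := fun r => Nat.rec g₀ (fun r y k => V r k * (L r k * y k)) r
  have hg₀ (k) : g 0 (k + 1) = R 0 k * L 0 (k + 1) * g 0 k := rfl
  have hg (r k) : g (r + 1) k = V r k * (L r k * g r k) := rfl
  have sq (x y : ℤˣ) : x * (x * y) = y := by rw [← mul_assoc, Int.units_mul_self, one_mul]
  refine ⟨fun r k => L r k * g r k, g, fun r k => ?_, fun r k => ?_, fun r k hr hk => ?_⟩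
  · rw [mul_assoc, Int.units_mul_self, mul_one]
  · rw [hg, mul_comm (V r k), sq]
  · induction r with
    | zero =>
      beta_reduce
      rw [hg₀, mul_assoc, mul_comm (R 0 k), mul_assoc, mul_assoc, Int.units_mul_self, mul_one, sq]
    | succ r ih =>
      have h := hflat r k hr hk
      have ih := ih (by omega)
      beta_reduce at ih ⊢
      rw [hg, hg]
      generalize L r k = l₁, L r (k + 1) = l₂, L (r + 1) (k + 1) = l₃, V r k = v₁,
        V r (k + 1) = v₂, R r k = r₁, R (r + 1) k = r₂, g r k = g₁, g r (k + 1) = g₂ at h ih ⊢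
      revert h ih l₁ l₂ l₃ v₁ v₂ r₁ r₂ g₁ g₂
      decide

/-- Gauge fixing for the parallelogram with notches at the up triangles `(0, k)` with `p k` and at
the down triangles `(a - 1, k)` with `q k`. -/
theorem exists_gauge (a W : ℕ) (p q : ℕ → Prop) (L R V : ℕ → ℕ → ℤˣ)
    (hflat : ∀ r k, r + 1 < a → k + 1 < W → ¬ (r = 0 ∧ p k) → ¬ (r + 2 = a ∧ q (k + 1)) →
      L r k * V r k * R (r + 1) k * L (r + 1) (k + 1) * V r (k + 1) * R r k = 1) :
    ∃ f g : ℕ → ℕ → ℤˣ, (∀ r k, L r k = f r k * g r k) ∧ (∀ r k, V r k = f r k * g (r + 1) k) ∧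
      ∀ r k, r < a → k + 1 < W → ¬ (r = 0 ∧ p k) → ¬ (r + 1 = a ∧ q (k + 1)) →
        R r k = f r (k + 1) * g r k := by
  classical
  -- The northeast edge at a removed triangle bounds just one inner hexagon, so its sign can be
  -- chosen to make that hexagon flat; the full parallelogram then applies.
  let R₁ : ℕ → ℕ → ℤˣ := fun r k => if r + 1 = a ∧ q (k + 1) then
    L (r - 1) k * V (r - 1) k * L r (k + 1) * V (r - 1) (k + 1) * R (r - 1) k else R r k
  let R₂ : ℕ → ℕ → ℤˣ := fun r k => if r = 0 ∧ p k then
    L r k * V r k * R₁ (r + 1) k * L (r + 1) (k + 1) * V r (k + 1) else R₁ r k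
  obtain ⟨f, g, hL, hV, hR⟩ := exists_gauge_of_full a W L R₂ V fun r k hr hk => by
    have h₁ : R₂ (r + 1) k = R₁ (r + 1) k := if_neg (by simp)
    have h₂ : R₁ r k = R r k := if_neg (by omega)
    rw [h₁]
    by_cases hp : r = 0 ∧ p k
    · rw [show R₂ r k = _ from if_pos hp, Int.units_mul_self]
    · rw [show R₂ r k = _ from if_neg hp, h₂]
      by_cases hq : r + 1 + 1 = a ∧ q (k + 1)
      · rw [show R₁ (r + 1) k = _ from if_pos hq, Nat.add_sub_cancel]
        generalize L r k = l₁, L (r + 1) (k + 1) = l₂, V r k = v₁, V r (k + 1) = v₂, R r k = r₁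
        revert l₁ l₂ v₁ v₂ r₁
        decide
      · rw [show R₁ (r + 1) k = _ from if_neg hq]
        exact hflat r k hr hk hp hq
  refine ⟨f, g, hL, hV, fun r k hr hk hp hq => ?_⟩
  rw [← hR r k hr hk, show R₂ r k = _ from if_neg hp, show R₁ r k = _ from if_neg hq]

end JacobiTrudi

/-! ### Comparison of the matrices -/

namespace JacobiTrudi

/-- The corner entry of the inverse of a bidiagonal matrix. -/
theorem exists_inverse_bidiagonal {S : Type} [CommRing S] (m : ℕ) (c : Fin (m + 1) → S) (H : S)
    (hH : (∏ i, c i) * H = 1) :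
    ∃ G : Matrix (Fin (m + 1)) (Fin (m + 1)) S,
      Matrix.of (fun r r' : Fin (m + 1) =>
        if r = r' then c r else if (r : ℕ) + 1 = r' then 1 else 0) * G = 1 ∧
      G 0 (Fin.last m) = (-1) ^ m * H := by
  set B : Matrix (Fin (m + 1)) (Fin (m + 1)) S := Matrix.of (fun r r' : Fin (m + 1) =>
    if r = r' then c r else if (r : ℕ) + 1 = r' then 1 else 0)
  have hdet : B.det = ∏ i, c i := by
    rw [Matrix.det_of_isUpperTriangular]
    · simp [B]
    · intro i j hij
      have : (j : ℕ) < i := hij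
      simp only [B, Matrix.of_apply, Fin.ext_iff]
      rw [if_neg (by omega), if_neg (by omega)]
  have hB : IsUnit B.det := by rw [hdet]; exact .of_mul_eq_one _ hH
  refine ⟨B⁻¹, Matrix.mul_nonsing_inv B hB, ?_⟩
  -- The last column of the inverse, by back substitution: entry r is (-1)^(m - r) / ∏_{i ≥ r} c_i,
  -- with `H` standing for 1 / ∏ c_i.
  let w : Fin (m + 1) → S := fun r => (-1) ^ (m + r : ℕ) * H * ∏ i ∈ Finset.Iio r, c i
  have hIic (r : Fin (m + 1)) : ∏ i ∈ Finset.Iic r, c i = c r * ∏ i ∈ Finset.Iio r, c i := by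
    rw [← Finset.Iio_insert, Finset.prod_insert (by simp)]
  have hw : B *ᵥ w = Pi.single (Fin.last m) 1 := by
    ext r
    rw [Matrix.mulVec, dotProduct]
    induction r using Fin.lastCases with
    | last =>
      rw [Finset.sum_eq_single (Fin.last m)]
      · have : Finset.Iic (Fin.last m) = Finset.univ := by ext; simp [Fin.le_last]
        have h := hIic (Fin.last m)
        rw [this] at h
        have hs : ((-1 : S)) ^ (m + m) = 1 := Even.neg_one_pow ⟨m, rfl⟩
        simp only [B, w, Matrix.of_apply, if_true, Fin.val_last, hs, one_mul, Pi.single_eq_same]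
        rw [← hH, h]
        ac_rfl
      · intro r' _ hr'
        simp only [B, Matrix.of_apply]
        rw [if_neg hr'.symm, if_neg (by simp; omega), zero_mul]
      · simp
    | cast r =>
      rw [Finset.sum_eq_add r.castSucc r.succ (by simp [Fin.ext_iff])]
      · have : Finset.Iio r.succ = Finset.Iic r.castSucc := by
          ext i
          simp only [Finset.mem_Iio, Finset.mem_Iic, Fin.lt_def, Fin.le_def, Fin.val_succ,
            Fin.val_castSucc]
          omega
        simp only [B, w, Matrix.of_apply, if_true, this, hIic]
        rw [if_neg (by simp [Fin.ext_iff]), if_pos (by simp),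
          Pi.single_eq_of_ne (Fin.castSucc_lt_last r).ne, Fin.val_succ, Fin.val_castSucc,
          ← add_assoc, pow_succ]
        ring
      · intro r' _ hr'
        have h₁ := Fin.val_succ r
        simp only [B, Matrix.of_apply, Fin.ext_iff, Fin.val_castSucc, ne_eq] at hr' ⊢
        rw [if_neg (by omega), if_neg (by omega), zero_mul]
      · simp
      · simp
  have h₂ : w 0 = B⁻¹ 0 (Fin.last m) := by
    have : B⁻¹ *ᵥ (B *ᵥ w) = w := by
      rw [Matrix.mulVec_mulVec, Matrix.nonsing_inv_mul B hB, Matrix.one_mulVec]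
    rw [← this, hw, Matrix.mulVec_single_one]
    rfl
  have h₃ : Finset.Iio (0 : Fin (m + 1)) = ∅ := by ext; simp
  rw [← h₂]
  simp [w, h₃]

variable {lam mu : YoungDiagram} {a : ℕ}

theorem toeplitz_prod_one_add (W : ℕ) (k l : Fin W) :
    PowerSeries.toeplitz W
      (∏ i : Fin a, (1 + PowerSeries.C (MvPolynomial.X i : MvPolynomial (Fin a) ℤ) *
        PowerSeries.X)) k l = e a ((k : ℤ) - l) := by
  rw [PowerSeries.toeplitz_apply, e, MvPolynomial.coeff_prod_one_add]
  by_cases hkl : l ≤ k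
  · have : (l : ℕ) ≤ k := hkl
    rw [if_pos hkl, if_pos (by omega), show ((k : ℤ) - l).toNat = k - l by omega]
  · have : ¬ (l : ℕ) ≤ k := hkl
    rw [if_neg hkl, if_neg (by omega)]

theorem toeplitz_hsymm (W : ℕ) (k l : Fin W) :
    PowerSeries.toeplitz W (PowerSeries.mk fun n => (-1) ^ n * MvPolynomial.hsymm (Fin a) ℤ n) k l =
      (-1) ^ (k : ℕ) * (-1) ^ (l : ℕ) * h a ((k : ℤ) - l) := by
  rw [PowerSeries.toeplitz_apply, h, PowerSeries.coeff_mk]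
  by_cases hkl : l ≤ k
  · obtain ⟨n, hn⟩ := Nat.exists_eq_add_of_le (show (l : ℕ) ≤ k from hkl)
    rw [if_pos hkl, if_pos (by omega), show ((k : ℤ) - l).toNat = k - l by omega, hn,
      Nat.add_sub_cancel_left, pow_add, mul_right_comm ((-1) ^ (l : ℕ)), ← mul_pow]
    simp
  · have : ¬ (l : ℕ) ≤ k := hkl
    rw [if_neg hkl, if_neg (by omega), mul_zero]

theorem stablyEquiv_jacobiTrudi_dual (hmu : mu ≤ lam) :
    StablyEquiv (jacobiTrudi lam mu a) (dualJacobiTrudi lam mu a)ᵀ := by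
  obtain ⟨εl, hεl⟩ := exists_equiv_notch (le_refl lam)
  obtain ⟨εm, hεm⟩ := exists_equiv_notch hmu
  obtain ⟨δl, hδl⟩ := exists_equiv_not_notch (le_refl lam)
  obtain ⟨δm, hδm⟩ := exists_equiv_not_notch hmu
  have hPQ := congrArg (PowerSeries.toeplitz (width lam))
    (MvPolynomial.prod_one_add_mul_hsymm (Fin a) ℤ)
  rw [map_mul, map_one] at hPQ
  have key := StablyEquiv.complementary hPQ (fun k => Notch (numParts lam) mu k)
    (fun k => Notch (numParts lam) lam k)
  refine .trans ?_ ((StablyEquiv.submatrix _ εl εm).symm.trans (key.trans ?_))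
  · refine StablyEquiv.of_units (fun i => (-1) ^ (εl i : ℕ)) (fun j => (-1) ^ (εm j : ℕ))
      fun i j => ?_
    rw [Matrix.submatrix_apply, Matrix.submatrix_apply, toeplitz_hsymm, jacobiTrudi,
      Matrix.of_apply]
    have h₁ := hεl i
    have h₂ := hεm j
    have h₃ : ((εl i : ℕ) : ℤ) - (εm j : ℕ) = lam.rowLen i - mu.rowLen j - i + j := by omega
    rw [h₃]
    simp
  · convert StablyEquiv.submatrix _ δm δl using 1
    ext1 j i
    rw [Matrix.submatrix_apply, Matrix.submatrix_apply, toeplitz_prod_one_add, dualJacobiTrudi,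
      Matrix.transpose_apply, Matrix.of_apply]
    have h₁ := hδl i
    have h₂ := hδm j
    congr 1
    omega

theorem stablyEquiv_jacobiTrudi_kasteleynPercus (hmu : mu ≤ lam) (ha : 0 < a) :
    StablyEquiv (jacobiTrudi lam mu a)
      (kasteleynPercus fun (_ : DownTriangle lam mu a) (_ : UpTriangle lam a) => 1) := by
  obtain ⟨m, rfl⟩ : ∃ m, a = m + 1 := ⟨a - 1, by omega⟩
  obtain ⟨εl, hεl⟩ := exists_equiv_notch (le_refl lam)
  obtain ⟨εm, hεm⟩ := exists_equiv_notch hmu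
  obtain ⟨G, hBG, hG⟩ := exists_inverse_bidiagonal m _ _
    (MvPolynomial.prod_one_add_mul_hsymm (Fin (m + 1)) ℤ)
  set T := PowerSeries.toeplitz (R := MvPolynomial (Fin (m + 1)) ℤ) (width lam)
  -- `Φ` replaces each power series entry by its Toeplitz block and flattens the blocks, so rows and
  -- columns are indexed by positions in the parallelogram.
  let Φ := (Matrix.compRingEquiv (Fin (m + 1)) (Fin (width lam))
    (MvPolynomial (Fin (m + 1)) ℤ)).toRingHom.comp T.mapMatrix
  have hPQ := congrArg Φ hBG
  rw [map_mul, map_one] at hPQ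
  let p : Fin (m + 1) × Fin (width lam) → Prop := fun t =>
    (t.1 : ℕ) + 1 = m + 1 ∧ Notch (numParts lam) mu t.2
  let q : Fin (m + 1) × Fin (width lam) → Prop := fun t =>
    (t.1 : ℕ) = 0 ∧ Notch (numParts lam) lam t.2
  let αl : {k : Fin (width lam) // Notch (numParts lam) lam k} ≃ {t // q t} :=
    { toFun := fun k => ⟨(0, k), rfl, k.2⟩
      invFun := fun t => ⟨t.1.2, t.2.2⟩
      left_inv := fun _ => rfl
      right_inv := fun t => Subtype.ext (Prod.ext (Fin.ext t.2.1.symm) rfl) }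
  let αm : {k : Fin (width lam) // Notch (numParts lam) mu k} ≃ {t // p t} :=
    { toFun := fun k => ⟨(Fin.last m, k), rfl, k.2⟩
      invFun := fun t => ⟨t.1.2, t.2.2⟩
      left_inv := fun _ => rfl
      right_inv := fun t => Subtype.ext (Prod.ext (Fin.ext (Nat.succ_injective t.2.1).symm) rfl) }
  have key := StablyEquiv.complementary hPQ p q
  refine .trans ?_ ((StablyEquiv.submatrix _ (εl.trans αl) (εm.trans αm)).symm.trans
    (key.trans ?_))
  · refine StablyEquiv.of_units (fun i => (-1) ^ m * (-1) ^ (εl i : ℕ))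
      (fun j => (-1) ^ (εm j : ℕ)) fun i j => ?_
    change T (G 0 (Fin.last m)) (εl i) (εm j) = _
    -- The left `(-1) ^ m` is a power of a matrix, the right one a scalar.
    have h₀ (M : Matrix (Fin (width lam)) (Fin (width lam)) (MvPolynomial (Fin (m + 1)) ℤ))
        (k l : Fin (width lam)) : ((-1) ^ m * M) k l = (-1) ^ m * M k l := by
      rcases m.even_or_odd with hm | hm <;> simp [hm.neg_one_pow]
    rw [hG, map_mul, map_pow, map_neg, map_one, h₀, toeplitz_hsymm, jacobiTrudi, Matrix.of_apply]
    have h₁ := hεl i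
    have h₂ := hεm j
    have h₃ : ((εl i : ℕ) : ℤ) - (εm j : ℕ) = lam.rowLen i - mu.rowLen j - i + j := by omega
    rw [h₃]
    simp [mul_assoc]
  · have hM : kasteleynPercus (fun (_ : DownTriangle lam mu (m + 1)) (_ : UpTriangle lam (m + 1)) =>
        1) = (Φ (Matrix.of fun r r' => if r = r' then
          1 + PowerSeries.C (MvPolynomial.X r) * PowerSeries.X else if (r : ℕ) + 1 = r' then 1 else
            0)).submatrix (fun t : {t // ¬ p t} => t.1) (fun t : {t // ¬ q t} => t.1) := by
      ext1 d u
      change ((1 : ℤ) : MvPolynomial (Fin (m + 1)) ℤ) * weight d u =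
        T (if d.row = u.row then 1 + PowerSeries.C (MvPolynomial.X d.row) * PowerSeries.X
          else if (d.row : ℕ) + 1 = u.row then 1 else 0) d.1.2 u.1.2
      have h₁ : d.1.2 = u.1.2 ↔ d.col = u.col := Fin.ext_iff
      have h₂ : (d.1.2 : ℕ) = u.1.2 + 1 ↔ d.col = u.col + 1 := Iff.rfl
      rw [Int.cast_one, one_mul, weight, LeftAdj, BaseAdj, RightAdj]
      by_cases hr : d.row = u.row
      · simp only [hr, if_true, true_and,
          PowerSeries.toeplitz_one_add_C_mul_X, h₁, h₂, T]
        simp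
      · by_cases hr' : (d.row : ℕ) + 1 = u.row
        · simp [hr, hr', T, Matrix.one_apply, h₁]
        · simp [hr, hr']
    rw [hM]
    exact .refl _

/-! ### Flat signs on the notched region -/

theorem DownTriangle.ext {d d' : DownTriangle lam mu a} (hr : (d.row : ℕ) = d'.row)
    (hc : d.col = d'.col) : d = d' :=
  Subtype.ext (Prod.ext (Fin.ext hr) (Fin.ext hc))

theorem UpTriangle.ext {u u' : UpTriangle lam a} (hr : (u.row : ℕ) = u'.row)
    (hc : u.col = u'.col) : u = u' :=
  Subtype.ext (Prod.ext (Fin.ext hr) (Fin.ext hc))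

/-- On the edges, flat signs come from signs of the triangles. -/
theorem KasteleynFlat.exists_gauge {s : DownTriangle lam mu a → UpTriangle lam a → ℤˣ}
    (hs : KasteleynFlat s) :
    ∃ (f : DownTriangle lam mu a → ℤˣ) (g : UpTriangle lam a → ℤˣ), ∀ d u,
      LeftAdj d u ∨ BaseAdj d u ∨ RightAdj d u → s d u = f d * g u := by
  let pos : DownTriangle lam mu a × UpTriangle lam a → (ℕ × ℕ) × (ℕ × ℕ) :=
    fun x => ((x.1.row, x.1.col), (x.2.row, x.2.col))
  have hpos : Function.Injective pos := by
    rintro ⟨d, u⟩ ⟨d', u'⟩ h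
    simp only [pos, Prod.mk.injEq] at h
    rw [DownTriangle.ext h.1.1 h.1.2, UpTriangle.ext h.2.1 h.2.2]
  -- Pairs of positions not occupied by triangles of the region get the harmless default sign 1.
  let S : ℕ → ℕ → ℕ → ℕ → ℤˣ := fun r k r' k' =>
    Function.extend pos (fun x => s x.1 x.2) 1 ((r, k), (r', k'))
  have hS (d u) : S d.row d.col u.row u.col = s d u := hpos.extend_apply _ _ (d, u)
  obtain ⟨f, g, hL, hV, hR⟩ := JacobiTrudi.exists_gauge a (width lam) (Notch (numParts lam) lam)
    (Notch (numParts lam) mu) (fun r k => S r k r k) (fun r k => S r (k + 1) r k)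
    (fun r k => S r k (r + 1) k) fun r k hr hk hp hq => by
      let u₁ : UpTriangle lam a := ⟨(⟨r, by omega⟩, ⟨k, by omega⟩), hp⟩
      let d₁ : DownTriangle lam mu a := ⟨(⟨r, by omega⟩, ⟨k, by omega⟩), fun h => by
        have := h.1; simp only at this; omega⟩
      let u₂ : UpTriangle lam a := ⟨(⟨r + 1, by omega⟩, ⟨k, by omega⟩), fun h => by
        have := h.1; simp only at this; omega⟩
      let d₂ : DownTriangle lam mu a := ⟨(⟨r + 1, by omega⟩, ⟨k + 1, by omega⟩), hq⟩
      let u₃ : UpTriangle lam a := ⟨(⟨r + 1, by omega⟩, ⟨k + 1, by omega⟩), fun h => by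
        have := h.1; simp only at this; omega⟩
      let d₃ : DownTriangle lam mu a := ⟨(⟨r, by omega⟩, ⟨k + 1, by omega⟩), fun h => by
        have := h.1; simp only at this; omega⟩
      have h := hs u₁ u₂ u₃ d₁ d₂ d₃ ⟨rfl, rfl⟩ ⟨rfl, rfl⟩ ⟨rfl, rfl⟩ ⟨rfl, rfl⟩ ⟨rfl, rfl⟩ ⟨rfl, rfl⟩
      simp only [← hS] at h
      exact h
  refine ⟨fun d => f d.row d.col, fun u => g u.row u.col, fun d u h => ?_⟩
  rw [← hS]
  beta_reduce
  rcases h with ⟨hr, hc⟩ | ⟨hr, hc⟩ | ⟨hr, hc⟩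
  · rw [hr, hc, ← hL]
  · rw [← hr, hc, ← hV]
  · have hd := d.2
    have hW : d.col < width lam := d.1.2.2
    change ¬ ((d.row : ℕ) + 1 = a ∧ Notch (numParts lam) mu d.col) at hd
    rw [hc] at hW
    rw [hr, hc] at hd ⊢
    exact hR _ _ u.row.2 hW u.2 hd

theorem KasteleynFlat.stablyEquiv_one {s : DownTriangle lam mu a → UpTriangle lam a → ℤˣ}
    (hs : KasteleynFlat s) :
    StablyEquiv (kasteleynPercus fun (_ : DownTriangle lam mu a) (_ : UpTriangle lam a) => 1)
      (kasteleynPercus s) := by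
  obtain ⟨f, g, hfg⟩ := hs.exists_gauge
  refine StablyEquiv.of_units f g fun d u => ?_
  simp only [kasteleynPercus, Matrix.of_apply]
  by_cases h : LeftAdj d u ∨ BaseAdj d u ∨ RightAdj d u
  · rw [hfg d u h]
    simp
  · have : weight d u = 0 := by
      push Not at h
      rw [weight, if_neg h.1, if_neg h.2.1, if_neg h.2.2]
    simp [this]

end JacobiTrudi

open JacobiTrudi in
theorem theorem3 (lam mu : YoungDiagram) (hmu : mu ≤ lam) (a : ℕ) (ha : 0 < a) :
    StablyEquiv (jacobiTrudi lam mu a) (dualJacobiTrudi lam mu a)ᵀ ∧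
    ∀ s : DownTriangle lam mu a → UpTriangle lam a → ℤˣ, KasteleynFlat s →
      StablyEquiv (jacobiTrudi lam mu a) (kasteleynPercus s) ∧
      StablyEquiv (dualJacobiTrudi lam mu a) (kasteleynPercus s)ᵀ := by
  have hJD := stablyEquiv_jacobiTrudi_dual (a := a) hmu
  refine ⟨hJD, fun s hs => ?_⟩
  have hJM := (stablyEquiv_jacobiTrudi_kasteleynPercus hmu ha).trans hs.stablyEquiv_one
  exact ⟨hJM, (hJD.symm.trans hJM).transpose⟩
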